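/- Let $n,h,d$ be positive integers. For all $i\in\{1,\dots,n\}$ and $k\in\{1,\dots,h\}$ let $\ell_i:\mathbb{R}\to\mathbb{R}$ and $g_{ik}:\mathbb{R}^d\to\mathbb{R}$ be strictly differentiable (at every point) and let $\sigma_{ik}:\mathbb{R}\to\mathbb{R}$ be locally Lipschitz. Consider the two-layer loss $$L(v,x)=\sum_{i=1}^n \ell_i\Big(\sum_{k=1}^h v_k\,\sigma_{ik}(g_{ik}(x))\Big),\qquad (v,x)\in\mathbb{R}^h\times\mathbb{R}^d.$$ For a locally Lipschitz function $f:\mathbb{R}^N\to\mathbb{R}$, the Clarke subdifferential $\partial_C f(x)$ is the convex hull of the set of all limits $\lim_j\nabla f(y_j)$ along sequences $y_j\to x$ of points at which $f$ is differentiable. Suppose that the mapping $\mathcal{G}:\mathbb{R}^d\to\mathbb{R}^{n\times h}$, $\mathcal{G}(x)=(g_{ik}(x))_{i,k}$, is locally surjective at $x'\in\mathbb{R}^d$, i.e. for every $t>0$ there is $r>0$ such that the closed ball of radius $r$ around $\mathcal{G}(x')$ is contained in the image under $\mathcal{G}$ of the closed ball of radius $t$ around $x'$. Then for every $v'\in\mathbb{R}^h$,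 $$\partial_C L(v',x')=\sum_{i=1}^n p_i\left(\prod_{k=1}^h\{\sigma_{ik}(g_{ik}(x'))\}\times\Big(\sum_{k=1}^h v'_k\cdot\partial_C\sigma_{ik}(g_{ik}(x'))\cdot\nabla g_{ik}(x')\Big)\right),$$ where $p_i=\ell_i'\big(\sum_{k=1}^h v'_k\,\sigma_{ik}(g_{ik}(x'))\big)$, the products of sets are Cartesian products (so that each summand is a subset of $\mathbb{R}^h\times\mathbb{R}^d$), and sums and multiples of sets are taken in the sense of Minkowski. -/

import Mathlib

open Filter Topology
open scoped Pointwise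

noncomputable section

/-- A map is strictly differentiable if it has a strict Fréchet derivative at every point. -/
def StrictlyDifferentiable {E F : Type*} [NormedAddCommGroup E] [NormedSpace ℝ E]
    [NormedAddCommGroup F] [NormedSpace ℝ F] (f : E → F) : Prop :=
  ∀ x, ∃ f' : E →L[ℝ] F, HasStrictFDerivAt f f' x

/-- The outer limit (Painlevé–Kuratowski limsup) of `{∇ f y}` as `y → x` within the set of points
at which `f` is differentiable. -/
def limitingGradients {E : Type*} [NormedAddCommGroup E] [InnerProductSpace ℝ E] [CompleteSpace E]
    (f : E → ℝ) (x : E) : Set E :=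
  {s | ∃ u : ℕ → E, (∀ j, DifferentiableAt ℝ f (u j)) ∧ Tendsto u atTop (𝓝 x) ∧
    Tendsto (fun j => gradient f (u j)) atTop (𝓝 s)}

/-- The Clarke subdifferential of a (locally Lipschitz) function on a Euclidean space. -/
def clarkeSubdifferential {E : Type*} [NormedAddCommGroup E] [InnerProductSpace ℝ E]
    [CompleteSpace E] (f : E → ℝ) (x : E) : Set E :=
  convexHull ℝ (limitingGradients f x)

/-- The local surjection property at `x`: for every `t > 0` there is `r > 0` such that the closed
ball of radius `r` around `F x` lies in the image of the closed ball of radius `t` around `x`. -/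
def LocallySurjectiveAt {E F : Type*} [NormedAddCommGroup E] [NormedAddCommGroup F]
    (f : E → F) (x : E) : Prop :=
  ∀ t : ℝ, 0 < t → ∃ r : ℝ, 0 < r ∧ Metric.closedBall (f x) r ⊆ f '' Metric.closedBall x t

/-- The Euclidean space `ℝ^h × ℝ^d` (with its `ℓ²` inner product) of all parameters `(v, x)`. -/
abbrev ParamSpace (h d : ℕ) : Type :=
  WithLp 2 (EuclideanSpace ℝ (Fin h) × EuclideanSpace ℝ (Fin d))

/-- The output `∑ₖ vₖ σᵢₖ(gᵢₖ(x))` of the two-layer network on the `i`-th sample. -/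
def networkOutput {n h d : ℕ} (σ : Fin n → Fin h → ℝ → ℝ)
    (g : Fin n → Fin h → EuclideanSpace ℝ (Fin d) → ℝ)
    (v : EuclideanSpace ℝ (Fin h)) (x : EuclideanSpace ℝ (Fin d)) (i : Fin n) : ℝ :=
  ∑ k, v k * σ i k (g i k x)

/-- The two-layer loss `L(v, x) = ∑ᵢ ℓᵢ(∑ₖ vₖ σᵢₖ(gᵢₖ(x)))`. -/
def twoLayerLoss {n h d : ℕ} (l : Fin n → ℝ → ℝ) (σ : Fin n → Fin h → ℝ → ℝ)
    (g : Fin n → Fin h → EuclideanSpace ℝ (Fin d) → ℝ) (z : ParamSpace h d) : ℝ :=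
  ∑ i, l i (networkOutput σ g z.fst z.snd i)

/-- The mapping `x ↦ (gᵢₖ(x))ᵢₖ` into `ℝ^{n × h}` with the Frobenius norm. -/
def innerMap {n h d : ℕ} (g : Fin n → Fin h → EuclideanSpace ℝ (Fin d) → ℝ)
    (x : EuclideanSpace ℝ (Fin d)) : EuclideanSpace ℝ (Fin n × Fin h) :=
  WithLp.toLp 2 fun ik => g ik.1 ik.2 x

/-- The Cartesian product of `A ⊆ ℝ^h` and `B ⊆ ℝ^d` as a subset of `ℝ^h × ℝ^d`. -/
def paramProd {h d : ℕ} (A : Set (EuclideanSpace ℝ (Fin h))) (B : Set (EuclideanSpace ℝ (Fin d))) :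
    Set (ParamSpace h d) :=
  {z | z.fst ∈ A ∧ z.snd ∈ B}

end

/-! Let `Γ a` be the chain-rule expression for the gradient of the loss at `(v', x')`, with the
derivatives of the activations replaced by slopes `a i k`. It is continuous and affine in `a`, and
the right-hand side is the image under `Γ` of the product of the sets `∂_C σᵢₖ(gᵢₖ(x'))`, hence
compact and convex.

For `⊆`, difference quotients of `σᵢₖ` near a point are averages of derivatives, so they are close
to the Clarke set (`exists_slope_isLittleO`). Strict differentiability carries this through the
network: increments of the loss near `(v', x')` are `⟨Γ m, p - q⟩ + o(‖p - q‖)` with `m` in the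
product (`isLittleO_twoLayerLoss`). By Hahn–Banach, a closed convex set of such slopes contains
every limiting gradient.

For `⊇`, convexity reduces to slopes `a i k` that are limiting gradients. Local surjectivity
realises the approximating points of all `σᵢₖ` at once as values of the `gᵢₖ` at one point near
`x'`, where the ordinary chain rule applies (`formalGradient_mem_limitingGradients`). -/

/-! ### Clarke subdifferentials in one real variable -/

theorem limitingGradients_eq_preimage_closure {E : Type*} [NormedAddCommGroup E]
    [InnerProductSpace ℝ E] [CompleteSpace E] (f : E → ℝ) (x : E) :
    limitingGradients f x = (fun s => (x, s)) ⁻¹'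
      closure ((fun y => (y, gradient f y)) '' {y | DifferentiableAt ℝ f y}) := by
  ext s
  simp only [Set.mem_preimage, mem_closure_iff_seq_limit]
  constructor
  · rintro ⟨u, hu, hux, hus⟩
    exact ⟨fun j => (u j, gradient f (u j)), fun j => ⟨u j, hu j, rfl⟩, hux.prodMk_nhds hus⟩
  · rintro ⟨w, hw, hlim⟩
    choose u hu huw using hw
    obtain rfl : (fun y => (u y, gradient f (u y))) = w := funext huw
    exact ⟨u, hu, (continuous_fst.tendsto _).comp hlim, (continuous_snd.tendsto _).comp hlim⟩

theorem isClosed_limitingGradients {E : Type*} [NormedAddCommGroup E]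
    [InnerProductSpace ℝ E] [CompleteSpace E] (f : E → ℝ) (x : E) :
    IsClosed (limitingGradients f x) := by
  rw [limitingGradients_eq_preimage_closure]
  exact isClosed_closure.preimage (by fun_prop)

theorem LocallyLipschitz.exists_eventually_norm_deriv_le {f : ℝ → ℝ} (hf : LocallyLipschitz f)
    (y : ℝ) : ∃ C : ℝ, ∀ᶠ w in 𝓝 y, ‖deriv f w‖ ≤ C := by
  obtain ⟨K, t, ht, hK⟩ := hf y
  refine ⟨K, ?_⟩
  filter_upwards [eventually_mem_nhds_iff.2 ht] with w hw
  exact norm_deriv_le_of_lipschitzOn hw hK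

theorem LocallyLipschitz.isCompact_limitingGradients {f : ℝ → ℝ} (hf : LocallyLipschitz f)
    (y : ℝ) : IsCompact (limitingGradients f y) := by
  obtain ⟨C, hC⟩ := hf.exists_eventually_norm_deriv_le y
  refine (isCompact_closedBall (0 : ℝ) C).of_isClosed_subset (isClosed_limitingGradients f y) ?_
  rintro s ⟨u, -, huy, hus⟩
  rw [mem_closedBall_zero_iff]
  refine le_of_tendsto hus.norm ?_
  filter_upwards [huy.eventually hC] with j hj
  rwa [gradient_eq_deriv']

theorem IsCompact.convexHull_real {s : Set ℝ} (hs : IsCompact s) : IsCompact (convexHull ℝ s) := by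
  rcases s.eq_empty_or_nonempty with rfl | hne
  · simp
  have : convexHull ℝ s = Set.Icc (sInf s) (sSup s) := by
    apply Set.Subset.antisymm
    · exact convexHull_min (fun a ha => ⟨csInf_le hs.bddBelow ha, le_csSup hs.bddAbove ha⟩)
        (convex_Icc _ _)
    · exact (convex_convexHull ℝ s).ordConnected.out
        (subset_convexHull ℝ s (hs.sInf_mem hne)) (subset_convexHull ℝ s (hs.sSup_mem hne))
  rw [this]
  exact isCompact_Icc

theorem LocallyLipschitz.isCompact_clarkeSubdifferential {f : ℝ → ℝ} (hf : LocallyLipschitz f)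
    (y : ℝ) : IsCompact (clarkeSubdifferential f y) :=
  (hf.isCompact_limitingGradients y).convexHull_real

/-- Otherwise derivatives at points tending to `y` stay off the thickening; being bounded, they
subconverge to a limiting gradient, a contradiction. -/
theorem LocallyLipschitz.eventually_deriv_mem_cthickening {f : ℝ → ℝ} (hf : LocallyLipschitz f)
    (y : ℝ) {ε : ℝ} (hε : 0 < ε) :
    ∀ᶠ w in 𝓝 y, DifferentiableAt ℝ f w →
      deriv f w ∈ Metric.cthickening ε (clarkeSubdifferential f y) := by
  by_contra hcon
  obtain ⟨C, hC⟩ := hf.exists_eventually_norm_deriv_le y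
  have hfreq : ∃ᶠ w in 𝓝 y, DifferentiableAt ℝ f w ∧
      deriv f w ∉ Metric.cthickening ε (clarkeSubdifferential f y) := by
    simpa only [Filter.not_eventually, Classical.not_imp] using hcon
  obtain ⟨u, huy, hu⟩ := exists_seq_forall_of_frequently (hfreq.and_eventually hC)
  obtain ⟨s, -, φ, hφ, hs⟩ := (isCompact_closedBall (0 : ℝ) C).tendsto_subseq
    (x := fun j => deriv f (u j)) (fun j => by simpa using (hu j).2)
  have hmem : s ∈ clarkeSubdifferential f y := by
    refine subset_convexHull ℝ _ ⟨u ∘ φ, fun j => (hu _).1.1, huy.comp hφ.tendsto_atTop, ?_⟩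
    simpa [gradient_eq_deriv'] using! hs
  have hnhds : Metric.cthickening ε (clarkeSubdifferential f y) ∈ 𝓝 s :=
    mem_of_superset (Metric.isOpen_thickening.mem_nhds (Metric.self_subset_thickening hε _ hmem))
      (Metric.thickening_subset_cthickening ε _)
  obtain ⟨j, hj⟩ := (hs.eventually hnhds).exists
  exact (hu (φ j)).1.2 hj

/-- By absolute continuity the quotient is the average of the derivative, and a closed convex set
containing the integrand almost everywhere contains its average. -/
theorem LocallyLipschitz.eventually_slope_mem_cthickening {f : ℝ → ℝ} (hf : LocallyLipschitz f)
    (y : ℝ) {ε : ℝ} (hε : 0 < ε) :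
    ∀ᶠ p : ℝ × ℝ in 𝓝 (y, y), p.1 ≠ p.2 →
      (f p.2 - f p.1) / (p.2 - p.1) ∈ Metric.cthickening ε (clarkeSubdifferential f y) := by
  obtain ⟨K, t, ht, hK⟩ := hf y
  obtain ⟨δ, hδ, hball⟩ := Metric.mem_nhds_iff.1
    (inter_mem ht (hf.eventually_deriv_mem_cthickening y hε))
  rw [nhds_prod_eq]
  filter_upwards [prod_mem_prod (Metric.ball_mem_nhds y hδ) (Metric.ball_mem_nhds y hδ)]
  rintro ⟨a, b⟩ ⟨ha, hb⟩ hab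
  simp only at ha hb hab ⊢
  have hsub : Set.uIcc a b ⊆ Metric.ball y δ :=
    (convex_ball y δ).ordConnected.uIcc_subset ha hb
  have hac : AbsolutelyContinuousOnInterval f a b :=
    (hK.mono fun w hw => (hball (hsub hw)).1).absolutelyContinuousOnInterval
  rw [← hac.integral_deriv_eq_sub, ← interval_average_eq_div]
  refine ((convex_convexHull ℝ _).cthickening ε).set_average_mem Metric.isClosed_cthickening
    ?_ ?_ ?_ ?_
  · rw [Set.uIoc, Real.volume_Ioc]
    simpa only [ne_eq, ENNReal.ofReal_eq_zero, not_le, sub_pos] using min_lt_max.2 hab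
  · rw [Set.uIoc]; exact measure_Ioc_lt_top.ne
  · rw [MeasureTheory.ae_restrict_iff' measurableSet_uIoc]
    filter_upwards [hac.ae_differentiableAt] with w hw hwab
    have := Set.uIoc_subset_uIcc hwab
    exact (hball (hsub this)).2 (hw this)
  · exact hac.intervalIntegrable_deriv.def'

/-- The thickening of the empty set is empty, yet it would have to contain difference quotients. -/
theorem LocallyLipschitz.clarkeSubdifferential_nonempty {f : ℝ → ℝ} (hf : LocallyLipschitz f)
    (y : ℝ) : (clarkeSubdifferential f y).Nonempty := by
  have h := hf.eventually_slope_mem_cthickening y one_pos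
  obtain ⟨w, hw, hwy⟩ := ((h.curry_nhds.self_of_nhds.filter_mono nhdsWithin_le_nhds).and
    (self_mem_nhdsWithin (a := y) (s := {y}ᶜ))).exists
  by_contra hempty
  rw [Set.not_nonempty_iff_eq_empty] at hempty
  simpa [hempty] using hw (Ne.symm hwy)

/-- The Clarke subdifferential of a locally Lipschitz function of one real variable contains
approximate slopes that make it a strict prederivative. -/
theorem LocallyLipschitz.exists_slope_isLittleO {f : ℝ → ℝ} (hf : LocallyLipschitz f) (y : ℝ) :
    ∃ m : ℝ × ℝ → ℝ, (∀ p, m p ∈ clarkeSubdifferential f y) ∧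
      (fun p : ℝ × ℝ => f p.1 - f p.2 - m p * (p.1 - p.2)) =o[𝓝 (y, y)]
        fun p => p.1 - p.2 := by
  have hK := hf.isCompact_clarkeSubdifferential y
  -- Taking the best slope in the compact set makes `m` independent of `ε`.
  have hex (p : ℝ × ℝ) := hK.exists_isMinOn (hf.clarkeSubdifferential_nonempty y)
    (f := fun a => ‖f p.1 - f p.2 - a * (p.1 - p.2)‖) (by fun_prop)
  choose m hm hmin using hex
  refine ⟨m, hm, Asymptotics.isLittleO_iff.2 fun ε hε => ?_⟩
  filter_upwards [hf.eventually_slope_mem_cthickening y hε] with p hp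
  rcases eq_or_ne p.1 p.2 with h | h
  · simp [h]
  have hne : p.2 - p.1 ≠ 0 := sub_ne_zero.2 h.symm
  have := hp h
  rw [hK.cthickening_eq_biUnion_closedBall hε.le] at this
  simp only [Set.mem_iUnion, Metric.mem_closedBall, exists_prop] at this
  obtain ⟨a, ha, hdist⟩ := this
  refine (hmin p ha).trans ?_
  have heq : f p.1 - f p.2 - a * (p.1 - p.2) =
      ((f p.2 - f p.1) / (p.2 - p.1) - a) * (p.1 - p.2) := by
    field_simp
    ring
  beta_reduce
  rw [heq, norm_mul]
  gcongr
  simpa [dist_eq_norm] using hdist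

/-! ### Bounding limiting gradients by separation -/

/-- A closed convex set which contains approximate slopes of `f` near `x` contains all limiting
gradients of `f` at `x`. -/
theorem limitingGradients_subset_of_isLittleO {E : Type*} [NormedAddCommGroup E]
    [InnerProductSpace ℝ E] [CompleteSpace E] {f : E → ℝ} {x : E} {C : Set E}
    (hconv : Convex ℝ C) (hclosed : IsClosed C) {m : E × E → E} (hm : ∀ p, m p ∈ C)
    (h : (fun p : E × E => f p.1 - f p.2 - inner ℝ (m p) (p.1 - p.2)) =o[𝓝 (x, x)]
      fun p => p.1 - p.2) :
    limitingGradients f x ⊆ C := by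
  rintro s ⟨u, hu, hux, hus⟩
  by_contra hs
  obtain ⟨F, c, hFC, hFs⟩ := geometric_hahn_banach_closed_point hconv hclosed hs
  set e : E := (InnerProductSpace.toDual ℝ E).symm F
  have hF (w : E) : inner ℝ w e = F w := by
    rw [real_inner_comm, InnerProductSpace.toDual_symm_apply]
  obtain ⟨ε, hε, hεlt⟩ : ∃ ε : ℝ, 0 < ε ∧ c + ε * ‖e‖ < F s := by
    refine ⟨(F s - c) / (2 * (‖e‖ + 1)), div_pos (by linarith) (by positivity), ?_⟩
    have : (F s - c) / (2 * (‖e‖ + 1)) * ‖e‖ ≤ (F s - c) / 2 := by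
      rw [div_mul_eq_mul_div, div_le_div_iff₀ (by positivity) two_pos]
      nlinarith [norm_nonneg e]
    linarith
  have hdiag : Tendsto (fun j => (u j, u j)) atTop (𝓝 (x, x)) := hux.prodMk_nhds hux
  have hlim : Tendsto (fun j => F (gradient f (u j))) atTop (𝓝 (F s)) :=
    (F.continuous.tendsto s).comp hus
  refine hεlt.not_ge (le_of_tendsto hlim ?_)
  -- `eventually_nhds` gives the estimate on a neighbourhood of `(u j, u j)`, so it can be used at
  -- the pairs `(u j + t • e, u j)` for small `t > 0`.
  filter_upwards [hdiag.eventually ((Asymptotics.isLittleO_iff.1 h) hε).eventually_nhds] with j hj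
  have hline : HasDerivAt (fun t : ℝ => f (u j + t • e)) (F (gradient f (u j))) 0 := by
    have h1 : HasFDerivAt f (fderiv ℝ f (u j)) (u j + (0 : ℝ) • e) := by
      simpa using (hu j).hasFDerivAt
    have h2 : HasDerivAt (fun t : ℝ => u j + t • e) e 0 := by
      simpa using ((hasDerivAt_id (0 : ℝ)).smul_const e).const_add (u j)
    have h3 := h1.comp_hasDerivAt (0 : ℝ) h2
    rwa [← toDual_gradient, InnerProductSpace.toDual_apply_apply, hF] at h3
  have hslope := hline.tendsto_slope_zero_right
  have hpath : Tendsto (fun t : ℝ => (u j + t • e, u j)) (𝓝[>] 0) (𝓝 (u j, u j)) := by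
    have : Continuous fun t : ℝ => (u j + t • e, u j) := by fun_prop
    simpa using (this.tendsto 0).mono_left nhdsWithin_le_nhds
  refine le_of_tendsto hslope ?_
  filter_upwards [hpath.eventually hj, self_mem_nhdsWithin] with t ht htpos
  have htpos : 0 < t := htpos
  simp only [add_sub_cancel_left, inner_smul_right, hF, norm_smul, Real.norm_eq_abs,
    abs_of_pos htpos] at ht
  have h1 := (abs_le.1 ht).2
  have h2 := mul_le_mul_of_nonneg_left (hFC _ (hm (u j + t • e, u j))).le htpos.le
  simp only [zero_add, zero_smul, add_zero, smul_eq_mul]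
  rw [inv_mul_le_iff₀ htpos]
  linarith

/-! ### Strict differentiability everywhere gives continuous derivatives -/

theorem StrictlyDifferentiable.hasStrictFDerivAt {E F : Type*} [NormedAddCommGroup E]
    [NormedSpace ℝ E] [NormedAddCommGroup F] [NormedSpace ℝ F] {f : E → F}
    (hf : StrictlyDifferentiable f) (x : E) : HasStrictFDerivAt f (fderiv ℝ f x) x := by
  obtain ⟨f', hf'⟩ := hf x
  rwa [hf'.hasFDerivAt.fderiv]

theorem StrictlyDifferentiable.hasStrictDerivAt {f : ℝ → ℝ}
    (hf : StrictlyDifferentiable f) (x : ℝ) : HasStrictDerivAt f (deriv f x) x :=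
  (hf.hasStrictFDerivAt x).hasStrictDerivAt

theorem StrictlyDifferentiable.continuous {E F : Type*} [NormedAddCommGroup E]
    [NormedSpace ℝ E] [NormedAddCommGroup F] [NormedSpace ℝ F] {f : E → F}
    (hf : StrictlyDifferentiable f) : Continuous f :=
  continuous_iff_continuousAt.2 fun x => (hf.hasStrictFDerivAt x).continuousAt

/-- Near `x`, `f` minus its linearisation at `x` is `ε / 2`-Lipschitz, which bounds its derivative
`fderiv ℝ f y - fderiv ℝ f x`. -/
theorem StrictlyDifferentiable.continuous_fderiv {E F : Type*} [NormedAddCommGroup E]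
    [NormedSpace ℝ E] [NormedAddCommGroup F] [NormedSpace ℝ F] {f : E → F}
    (hf : StrictlyDifferentiable f) : Continuous (fderiv ℝ f) := by
  refine continuous_iff_continuousAt.2 fun x => Metric.tendsto_nhds.2 fun ε hε => ?_
  have h := (Asymptotics.isLittleO_iff.1 (hf.hasStrictFDerivAt x).isLittleO)
    (half_pos hε)
  have hdiag : Tendsto (fun y : E => (y, y)) (𝓝 x) (𝓝 (x, x)) := tendsto_id.prodMk_nhds tendsto_id
  filter_upwards [hdiag.eventually h.eventually_nhds] with y hy
  have hfix : Tendsto (fun w : E => (w, y)) (𝓝 y) (𝓝 (y, y)) :=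
    tendsto_id.prodMk_nhds tendsto_const_nhds
  have hd : HasFDerivAt (fun w => f w - fderiv ℝ f x w) (fderiv ℝ f y - fderiv ℝ f x) y :=
    (hf.hasStrictFDerivAt y).hasFDerivAt.sub (fderiv ℝ f x).hasFDerivAt
  have hle := hd.le_of_lip' (half_pos hε).le (by
    filter_upwards [hfix.eventually hy] with w hw
    rw [sub_sub_sub_comm, ← map_sub]
    exact hw)
  rw [dist_eq_norm]
  linarith

theorem StrictlyDifferentiable.continuous_deriv {f : ℝ → ℝ}
    (hf : StrictlyDifferentiable f) : Continuous (deriv f) :=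
  (hf.continuous_fderiv.clm_apply continuous_const : Continuous fun y => fderiv ℝ f y 1)

theorem StrictlyDifferentiable.continuous_gradient {E : Type*} [NormedAddCommGroup E]
    [InnerProductSpace ℝ E] [CompleteSpace E] {f : E → ℝ}
    (hf : StrictlyDifferentiable f) : Continuous (gradient f) :=
  (InnerProductSpace.toDual ℝ E).symm.continuous.comp hf.continuous_fderiv

/-! ### The formal gradient -/

/-- The gradient of the two-layer loss at `(v, x)` when the derivatives of the activation functions
`σ i k` at `g i k x` are replaced by the slopes `a i k`. -/
noncomputable def formalGradient {n h d : ℕ} (l : Fin n → ℝ → ℝ) (σ : Fin n → Fin h → ℝ → ℝ)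
    (g : Fin n → Fin h → EuclideanSpace ℝ (Fin d) → ℝ)
    (v : EuclideanSpace ℝ (Fin h)) (x : EuclideanSpace ℝ (Fin d)) (a : Fin n → Fin h → ℝ) :
    ParamSpace h d :=
  ∑ i, deriv (l i) (networkOutput σ g v x i) •
    WithLp.toLp 2 (WithLp.toLp 2 (fun k => σ i k (g i k x)),
      ∑ k, v k • a i k • gradient (g i k) x)

section

variable {n h d : ℕ} {l : Fin n → ℝ → ℝ} {σ : Fin n → Fin h → ℝ → ℝ}
  {g : Fin n → Fin h → EuclideanSpace ℝ (Fin d) → ℝ}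

theorem inner_formalGradient (v : EuclideanSpace ℝ (Fin h)) (x : EuclideanSpace ℝ (Fin d))
    (a : Fin n → Fin h → ℝ) (w : ParamSpace h d) :
    inner ℝ (formalGradient l σ g v x a) w = ∑ i, deriv (l i) (networkOutput σ g v x i) *
      ∑ k, (w.fst k * σ i k (g i k x) + v k * (a i k * fderiv ℝ (g i k) x w.snd)) := by
  rw [formalGradient, sum_inner]
  refine Finset.sum_congr rfl fun i _ => ?_
  rw [real_inner_smul_left, WithLp.prod_inner_apply, PiLp.inner_apply, sum_inner,
    Finset.sum_add_distrib]
  simp only [real_inner_smul_left, ← toDual_gradient, InnerProductSpace.toDual_apply_apply]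
  rfl

theorem hasGradientAt_twoLayerLoss (hl : ∀ i, StrictlyDifferentiable (l i))
    (hg : ∀ i k, StrictlyDifferentiable (g i k))
    (v : EuclideanSpace ℝ (Fin h)) (x : EuclideanSpace ℝ (Fin d))
    (hσ : ∀ i k, DifferentiableAt ℝ (σ i k) (g i k x)) :
    HasGradientAt (twoLayerLoss l σ g)
      (formalGradient l σ g v x fun i k => deriv (σ i k) (g i k x)) (WithLp.toLp 2 (v, x)) := by
  set z : ParamSpace h d := WithLp.toLp 2 (v, x) with hz
  have hgz (i : Fin n) (k : Fin h) : HasFDerivAt (fun z : ParamSpace h d => g i k z.snd)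
      ((fderiv ℝ (g i k) x).comp (WithLp.sndL 2 ℝ _ _)) z :=
    HasFDerivAt.comp z (f := WithLp.sndL 2 ℝ _ _) ((hg i k).hasStrictFDerivAt x).hasFDerivAt
      (WithLp.sndL 2 ℝ _ _).hasFDerivAt
  have hvz (k : Fin h) : HasFDerivAt (fun z : ParamSpace h d => z.fst k)
      ((EuclideanSpace.proj k).comp (WithLp.fstL 2 ℝ _ _)) z :=
    ((EuclideanSpace.proj k).comp (WithLp.fstL 2 ℝ _ _)).hasFDerivAt
  have hN (i : Fin n) := HasFDerivAt.fun_sum (u := Finset.univ) fun k _ =>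
    (hvz k).mul (HasDerivAt.comp_hasFDerivAt z (hσ i k).hasDerivAt (hgz i k))
  have hL := HasFDerivAt.fun_sum (u := Finset.univ) fun i _ =>
    HasDerivAt.comp_hasFDerivAt z ((hl i).hasStrictDerivAt _).hasDerivAt (hN i)
  rw [hasGradientAt_iff_hasFDerivAt]
  refine hL.congr_fderiv ?_
  ext w
  rw [InnerProductSpace.toDual_apply_apply, inner_formalGradient]
  simp [networkOutput, z, add_comm, mul_comm]

theorem continuous_formalGradient (hl : ∀ i, StrictlyDifferentiable (l i))
    (hg : ∀ i k, StrictlyDifferentiable (g i k)) (hσ : ∀ i k, LocallyLipschitz (σ i k))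
    (v : EuclideanSpace ℝ (Fin h)) :
    Continuous fun p : EuclideanSpace ℝ (Fin d) × (Fin n → Fin h → ℝ) =>
      formalGradient l σ g v p.1 p.2 := by
  have hS (i : Fin n) (k : Fin h) : Continuous
      fun p : EuclideanSpace ℝ (Fin d) × (Fin n → Fin h → ℝ) => σ i k (g i k p.1) :=
    (hσ i k).continuous.comp ((hg i k).continuous.comp continuous_fst)
  refine continuous_finsetSum _ fun i _ => Continuous.fun_smul ?_ ?_
  · exact (hl i).continuous_deriv.comp
      (continuous_finsetSum _ fun k _ => continuous_const.mul (hS i k))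
  · refine (WithLp.prod_continuous_toLp 2 _ _).comp (Continuous.prodMk ?_ ?_)
    · exact (PiLp.continuous_toLp 2 _).comp (continuous_pi fun k => hS i k)
    · refine continuous_finsetSum _ fun k _ => Continuous.fun_smul continuous_const (Continuous.fun_smul ?_ ?_)
      · fun_prop
      · exact (hg i k).continuous_gradient.comp continuous_fst

/-- The `v`-component does not depend on the slopes, so the map is affine rather than linear and the
weights must sum to one. -/
theorem formalGradient_convex_combination (v : EuclideanSpace ℝ (Fin h))
    (x : EuclideanSpace ℝ (Fin d)) {a b : Fin n → Fin h → ℝ} {s t : ℝ} (hst : s + t = 1) :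
    formalGradient l σ g v x (s • a + t • b) =
      s • formalGradient l σ g v x a + t • formalGradient l σ g v x b := by
  refine ext_inner_right ℝ fun w => ?_
  rw [inner_add_left, real_inner_smul_left, real_inner_smul_left]
  simp only [inner_formalGradient, Finset.mul_sum, ← Finset.sum_add_distrib, Pi.add_apply,
    Pi.smul_apply, smul_eq_mul]
  refine Finset.sum_congr rfl fun i _ => Finset.sum_congr rfl fun k _ => ?_
  obtain rfl : s = 1 - t := by linarith
  ring

/-- Each set `K i k` occurs once in the Minkowski sum, so the choices of elements are independent
and amount to one point `a` of the product. -/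
theorem sum_smul_paramProd_eq_image (v : EuclideanSpace ℝ (Fin h))
    (x : EuclideanSpace ℝ (Fin d)) (K : Fin n → Fin h → Set ℝ) :
    ∑ i, deriv (l i) (networkOutput σ g v x i) •
        paramProd {w | ∀ k, w k ∈ ({σ i k (g i k x)} : Set ℝ)}
          (∑ k, v k • (K i k • ({gradient (g i k) x} : Set (EuclideanSpace ℝ (Fin d))))) =
      formalGradient l σ g v x ''
        Set.univ.pi fun i => Set.univ.pi fun k => K i k := by
  ext z
  simp only [Set.mem_finsetSum, Set.mem_image]
  constructor
  · rintro ⟨f, hf, rfl⟩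
    have hex (i : Fin n) : ∃ a : Fin h → ℝ, (∀ k, a k ∈ K i k) ∧
        f i = deriv (l i) (networkOutput σ g v x i) •
          WithLp.toLp 2 (WithLp.toLp 2 (fun k => σ i k (g i k x)),
            ∑ k, v k • a k • gradient (g i k) x) := by
      obtain ⟨y, ⟨hy1, hy2⟩, hyf⟩ := hf (Finset.mem_univ i)
      obtain ⟨b, hb, hby⟩ := (Set.mem_finsetSum _ _ _).1 hy2
      have hb' (k : Fin h) : ∃ a ∈ K i k, v k • a • gradient (g i k) x = b k := by
        obtain ⟨c, hc, hcb⟩ := hb (Finset.mem_univ k)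
        obtain ⟨a, ha, e, rfl, rfl⟩ := hc
        exact ⟨a, ha, hcb⟩
      choose a ha hab using hb'
      refine ⟨a, ha, ?_⟩
      rw [← hyf]
      congr 1
      have h1 : y.fst = WithLp.toLp 2 (fun k => σ i k (g i k x)) := by
        ext k
        exact hy1 k
      have h2 : y.snd = ∑ k, v k • a k • gradient (g i k) x := by
        rw [← hby]
        exact Finset.sum_congr rfl fun k _ => (hab k).symm
      rw [← h1, ← h2]
      rfl
    choose a ha hfa using hex
    refine ⟨a, fun i _ k _ => ha i k, ?_⟩
    exact Finset.sum_congr rfl fun i _ => (hfa i).symm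
  · rintro ⟨a, ha, rfl⟩
    refine ⟨fun i => deriv (l i) (networkOutput σ g v x i) •
      WithLp.toLp 2 (WithLp.toLp 2 (fun k => σ i k (g i k x)),
        ∑ k, v k • a i k • gradient (g i k) x), fun {i} _ => Set.smul_mem_smul_set ⟨fun k => rfl, ?_⟩, rfl⟩
    refine (Set.mem_finsetSum _ _ _).2 ⟨_, fun {k} _ => Set.smul_mem_smul_set ?_, rfl⟩
    exact Set.smul_mem_smul (ha i trivial k trivial) rfl

/-! ### Propagating approximate slopes through the network -/

/-- Approximate slopes of an outer function on `ℝ` give approximate slopes of the composition with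
a strictly differentiable inner function. -/
theorem isLittleO_comp_of_hasStrictFDerivAt {E : Type*} [NormedAddCommGroup E] [NormedSpace ℝ E]
    {s : ℝ → ℝ} {f : E → ℝ} {f' : E →L[ℝ] ℝ} {z : E} {m : ℝ × ℝ → ℝ} {C : ℝ}
    (hf : HasStrictFDerivAt f f' z) (hmC : ∀ p, ‖m p‖ ≤ C)
    (hm : (fun p : ℝ × ℝ => s p.1 - s p.2 - m p * (p.1 - p.2)) =o[𝓝 (f z, f z)]
      fun p => p.1 - p.2) :
    (fun p : E × E => s (f p.1) - s (f p.2) - m (f p.1, f p.2) * f' (p.1 - p.2)) =o[𝓝 (z, z)]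
      fun p => p.1 - p.2 := by
  have ht : Tendsto (fun p : E × E => (f p.1, f p.2)) (𝓝 (z, z)) (𝓝 (f z, f z)) :=
    (hf.continuousAt.comp (f := Prod.fst) (x := (z, z)) continuousAt_fst).prodMk_nhds
      (hf.continuousAt.comp (f := Prod.snd) (x := (z, z)) continuousAt_snd)
  have h1 := (hm.comp_tendsto ht).trans_isBigO hf.isBigO_sub
  have h2 : (fun p : E × E => m (f p.1, f p.2)) =O[𝓝 (z, z)] fun _ => (1 : ℝ) :=
    .of_bound C (.of_forall fun p => by simpa using hmC _)
  have h3 := h2.mul_isLittleO hf.isLittleO.norm_right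
  simp only [one_mul] at h3
  refine (h1.add h3.of_norm_right).congr_left fun p => ?_
  simp only [Function.comp_apply]
  ring

/-- The increment is `(w p.1 - w p.2) * S p.1 + w p.2 * (S p.1 - S p.2)`; freezing `S` and `w` at
`z` costs a vanishing factor times a term of order `p.1 - p.2`. -/
theorem isLittleO_mul_of_isLittleO {E : Type*} [NormedAddCommGroup E] [NormedSpace ℝ E]
    {w S : E → ℝ} {w' : E →L[ℝ] ℝ} {T : E × E → ℝ} {z : E} (hw : HasStrictFDerivAt w w' z)
    (hS : ContinuousAt S z) (hT : T =O[𝓝 (z, z)] fun p => p.1 - p.2)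
    (hST : (fun p : E × E => S p.1 - S p.2 - T p) =o[𝓝 (z, z)] fun p => p.1 - p.2) :
    (fun p : E × E => w p.1 * S p.1 - w p.2 * S p.2 - (w' (p.1 - p.2) * S z + w z * T p))
      =o[𝓝 (z, z)] fun p => p.1 - p.2 := by
  have hS1 : Tendsto (fun p : E × E => S p.1 - S z) (𝓝 (z, z)) (𝓝 0) := by
    have := (hS.comp (f := Prod.fst) (x := (z, z)) continuousAt_fst).sub_const (S z)
    simpa [ContinuousAt] using this
  have hw2 : Tendsto (fun p : E × E => w p.2) (𝓝 (z, z)) (𝓝 (w z)) :=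
    hw.continuousAt.comp (f := Prod.snd) (x := (z, z)) continuousAt_snd
  have hw3 : Tendsto (fun p : E × E => w p.2 - w z) (𝓝 (z, z)) (𝓝 0) := by
    simpa using hw2.sub_const (w z)
  have h1 := ((Asymptotics.isLittleO_one_iff ℝ).2 hS1).mul_isBigO hw.isBigO_sub.norm_right
  have h2 := ((Asymptotics.isLittleO_one_iff ℝ).2 hw3).mul_isBigO hT.norm_right
  have h3 := (hw2.isBigO_one ℝ).mul_isLittleO hST.norm_right
  have h4 := hw.isLittleO.norm_right.const_mul_left (S z)
  simp only [one_mul] at h1 h2 h3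
  refine ((h1.add h2).add (h3.add h4)).of_norm_right.congr_left fun p => ?_
  ring

/-- `T` need not be linear in `p.1 - p.2`, since the slopes vary with the pair; only its order of
magnitude matters. -/
theorem isLittleO_comp_of_hasStrictDerivAt {E : Type*} [NormedAddCommGroup E] [NormedSpace ℝ E]
    {φ : ℝ → ℝ} {N : E → ℝ} {c : ℝ} {T : E × E → ℝ} {z : E} (hφ : HasStrictDerivAt φ c (N z))
    (hN : ContinuousAt N z) (hT : T =O[𝓝 (z, z)] fun p => p.1 - p.2)
    (hNT : (fun p : E × E => N p.1 - N p.2 - T p) =o[𝓝 (z, z)] fun p => p.1 - p.2) :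
    (fun p : E × E => φ (N p.1) - φ (N p.2) - c * T p) =o[𝓝 (z, z)] fun p => p.1 - p.2 := by
  have ht : Tendsto (fun p : E × E => (N p.1, N p.2)) (𝓝 (z, z)) (𝓝 (N z, N z)) :=
    (hN.comp (f := Prod.fst) (x := (z, z)) continuousAt_fst).prodMk_nhds
      (hN.comp (f := Prod.snd) (x := (z, z)) continuousAt_snd)
  have hNO : (fun p : E × E => N p.1 - N p.2) =O[𝓝 (z, z)] fun p => p.1 - p.2 :=
    (hNT.isBigO.add hT).congr_left fun p => by ring
  have h1 := (hφ.hasStrictFDerivAt.isLittleO.comp_tendsto ht).trans_isBigO hNO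
  refine (h1.add (hNT.const_mul_left c)).congr_left fun p => ?_
  simp
  ring

theorem isLittleO_comp_sum_mul_comp {E ι : Type*} [NormedAddCommGroup E] [NormedSpace ℝ E]
    [Fintype ι] {φ : ℝ → ℝ} {c : ℝ} {w f : ι → E → ℝ} {w' f' : ι → E →L[ℝ] ℝ} {s : ι → ℝ → ℝ}
    {m : ι → ℝ × ℝ → ℝ} {C : ι → ℝ} {z : E}
    (hφ : HasStrictDerivAt φ c (∑ k, w k z * s k (f k z)))
    (hw : ∀ k, HasStrictFDerivAt (w k) (w' k) z) (hf : ∀ k, HasStrictFDerivAt (f k) (f' k) z)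
    (hs : ∀ k, Continuous (s k)) (hmC : ∀ k p, ‖m k p‖ ≤ C k)
    (hm : ∀ k, (fun p : ℝ × ℝ => s k p.1 - s k p.2 - m k p * (p.1 - p.2))
      =o[𝓝 (f k z, f k z)] fun p => p.1 - p.2) :
    (fun p : E × E => φ (∑ k, w k p.1 * s k (f k p.1)) - φ (∑ k, w k p.2 * s k (f k p.2)) -
      c * ∑ k, (w' k (p.1 - p.2) * s k (f k z) +
        w k z * (m k (f k p.1, f k p.2) * f' k (p.1 - p.2)))) =o[𝓝 (z, z)]
      fun p => p.1 - p.2 := by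
  have hS (k : ι) : ContinuousAt (fun z => s k (f k z)) z :=
    (hs k).continuousAt.comp (hf k).continuousAt
  have hlin (A : E →L[ℝ] ℝ) : (fun p : E × E => A (p.1 - p.2)) =O[𝓝 (z, z)] fun p => p.1 - p.2 :=
    A.isBigO_comp _ _
  have hT (k : ι) : (fun p : E × E => m k (f k p.1, f k p.2) * f' k (p.1 - p.2))
      =O[𝓝 (z, z)] fun p => p.1 - p.2 := by
    have h2 : (fun p : E × E => m k (f k p.1, f k p.2)) =O[𝓝 (z, z)] fun _ => (1 : ℝ) :=
      .of_bound (C k) (.of_forall fun p => by simpa using hmC k _)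
    have h3 := h2.mul (hlin (f' k)).norm_right
    simp only [one_mul] at h3
    exact h3.of_norm_right
  have hwS (k : ι) := isLittleO_mul_of_isLittleO (hw k) (hS k) (hT k)
    (isLittleO_comp_of_hasStrictFDerivAt (hf k) (hmC k) (hm k))
  have hTN := Asymptotics.IsBigO.fun_sum (s := Finset.univ) fun k _ =>
    ((hlin (w' k)).const_mul_left (s k (f k z))).add ((hT k).const_mul_left (w k z))
  simp only [mul_comm (s _ (f _ z))] at hTN
  refine isLittleO_comp_of_hasStrictDerivAt (N := fun z => ∑ k, w k z * s k (f k z)) hφ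
    (tendsto_finsetSum _ fun k _ => (hw k).continuousAt.mul (hS k)) hTN
    ((Asymptotics.IsLittleO.fun_sum (s := Finset.univ) fun k _ => hwS k).congr_left fun p => ?_)
  simp only [Finset.sum_sub_distrib]

/-- Only the slopes move with the pair `p`; all else is frozen at `(v, x)`, which keeps the
approximate gradients in one fixed convex set. -/
theorem isLittleO_twoLayerLoss (hl : ∀ i, StrictlyDifferentiable (l i))
    (hg : ∀ i k, StrictlyDifferentiable (g i k)) (hσ : ∀ i k, LocallyLipschitz (σ i k))
    (v : EuclideanSpace ℝ (Fin h)) (x : EuclideanSpace ℝ (Fin d))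
    {m : Fin n → Fin h → ℝ × ℝ → ℝ} {C : Fin n → Fin h → ℝ} (hmC : ∀ i k p, ‖m i k p‖ ≤ C i k)
    (hm : ∀ i k, (fun p : ℝ × ℝ => σ i k p.1 - σ i k p.2 - m i k p * (p.1 - p.2))
      =o[𝓝 (g i k x, g i k x)] fun p => p.1 - p.2) :
    (fun p : ParamSpace h d × ParamSpace h d => twoLayerLoss l σ g p.1 - twoLayerLoss l σ g p.2 -
      inner ℝ (formalGradient l σ g v x fun i k => m i k (g i k p.1.snd, g i k p.2.snd))
        (p.1 - p.2)) =o[𝓝 (WithLp.toLp 2 (v, x), WithLp.toLp 2 (v, x))] fun p => p.1 - p.2 := by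
  set z : ParamSpace h d := WithLp.toLp 2 (v, x) with hz
  have hgz (i : Fin n) (k : Fin h) : HasStrictFDerivAt (fun z : ParamSpace h d => g i k z.snd)
      ((fderiv ℝ (g i k) x).comp (WithLp.sndL 2 ℝ _ _)) z :=
    HasStrictFDerivAt.comp z (f := WithLp.sndL 2 ℝ _ _) ((hg i k).hasStrictFDerivAt x)
      (WithLp.sndL 2 ℝ _ _).hasStrictFDerivAt
  have hvz (k : Fin h) : HasStrictFDerivAt (fun z : ParamSpace h d => z.fst k)
      ((EuclideanSpace.proj k).comp (WithLp.fstL 2 ℝ _ _)) z :=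
    ((EuclideanSpace.proj k).comp (WithLp.fstL 2 ℝ _ _)).hasStrictFDerivAt
  have hφ (i : Fin n) := isLittleO_comp_sum_mul_comp ((hl i).hasStrictDerivAt _) hvz (hgz i)
    (fun k => (hσ i k).continuous) (hmC i) (hm i)
  refine (Asymptotics.IsLittleO.fun_sum (s := Finset.univ) fun i _ => hφ i).congr_left
    fun p => ?_
  simp only [inner_formalGradient, twoLayerLoss, Finset.sum_sub_distrib]
  rfl

theorem convex_image_formalGradient (v : EuclideanSpace ℝ (Fin h))
    (x : EuclideanSpace ℝ (Fin d)) {K : Set (Fin n → Fin h → ℝ)} (hK : Convex ℝ K) :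
    Convex ℝ (formalGradient l σ g v x '' K) := by
  rintro _ ⟨a, ha, rfl⟩ _ ⟨b, hb, rfl⟩ s t hs ht hst
  exact ⟨s • a + t • b, hK ha hb hs ht hst, formalGradient_convex_combination v x hst⟩

theorem clarkeSubdifferential_twoLayerLoss_subset (hl : ∀ i, StrictlyDifferentiable (l i))
    (hg : ∀ i k, StrictlyDifferentiable (g i k)) (hσ : ∀ i k, LocallyLipschitz (σ i k))
    (v : EuclideanSpace ℝ (Fin h)) (x : EuclideanSpace ℝ (Fin d)) :
    clarkeSubdifferential (twoLayerLoss l σ g) (WithLp.toLp 2 (v, x)) ⊆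
      formalGradient l σ g v x '' Set.univ.pi fun i => Set.univ.pi fun k =>
        clarkeSubdifferential (σ i k) (g i k x) := by
  have hconv := convex_image_formalGradient (l := l) (σ := σ) (g := g) v x
    (convex_pi (s := Set.univ) fun i _ => convex_pi (s := Set.univ) fun k _ =>
      convex_convexHull ℝ (limitingGradients (σ i k) (g i k x)))
  have hcomp : IsCompact (Set.univ.pi fun i => Set.univ.pi fun k =>
      clarkeSubdifferential (σ i k) (g i k x)) :=
    isCompact_univ_pi fun i => isCompact_univ_pi fun k =>
      (hσ i k).isCompact_clarkeSubdifferential _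
  have hcont : Continuous (fun a => formalGradient l σ g v x a) :=
    (continuous_formalGradient hl hg hσ v).comp (f := fun a => (x, a)) (Continuous.prodMk_right x)
  choose m hslope using fun i k => (hσ i k).exists_slope_isLittleO (g i k x)
  have hm (i : Fin n) (k : Fin h) := (hslope i k).1
  have hmo (i : Fin n) (k : Fin h) := (hslope i k).2
  choose C hC using fun i k =>
    ((hσ i k).isCompact_clarkeSubdifferential (g i k x)).isBounded.exists_norm_le
  have hclosed := (hcomp.image hcont).isClosed
  have hmC (i : Fin n) (k : Fin h) (p : ℝ × ℝ) : ‖m i k p‖ ≤ C i k := hC i k _ (hm i k p)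
  have hmem (p : ParamSpace h d × ParamSpace h d) :
      formalGradient l σ g v x (fun i k => m i k (g i k p.1.snd, g i k p.2.snd)) ∈
        formalGradient l σ g v x '' Set.univ.pi fun i => Set.univ.pi fun k =>
          clarkeSubdifferential (σ i k) (g i k x) :=
    Set.mem_image_of_mem _ fun i _ k _ => hm i k _
  have hsmall := isLittleO_twoLayerLoss hl hg hσ v x hmC hmo
  have hlim := limitingGradients_subset_of_isLittleO hconv hclosed hmem hsmall
  exact convexHull_min hlim hconv

/-! ### The reverse inclusion, by local surjectivity -/

theorem formalGradient_mem_limitingGradients (hl : ∀ i, StrictlyDifferentiable (l i))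
    (hg : ∀ i k, StrictlyDifferentiable (g i k)) (hσ : ∀ i k, LocallyLipschitz (σ i k))
    (v : EuclideanSpace ℝ (Fin h)) {x : EuclideanSpace ℝ (Fin d)}
    (hG : LocallySurjectiveAt (innerMap g) x) {a : Fin n → Fin h → ℝ}
    (ha : ∀ i k, a i k ∈ limitingGradients (σ i k) (g i k x)) :
    formalGradient l σ g v x a ∈
      limitingGradients (twoLayerLoss l σ g) (WithLp.toLp 2 (v, x)) := by
  have hex (i : Fin n) (k : Fin h) : ∃ u : ℕ → ℝ, (∀ j, DifferentiableAt ℝ (σ i k) (u j)) ∧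
      Tendsto u atTop (𝓝 (g i k x)) ∧
      Tendsto (fun j => gradient (σ i k) (u j)) atTop (𝓝 (a i k)) := ha i k
  choose u hseq using hex
  have hu (i : Fin n) (k : Fin h) := (hseq i k).1
  have hux (i : Fin n) (k : Fin h) := (hseq i k).2.1
  have hua (i : Fin n) (k : Fin h) := (hseq i k).2.2
  let y (j : ℕ) : EuclideanSpace ℝ (Fin n × Fin h) := WithLp.toLp 2 fun ik => u ik.1 ik.2 j
  have hy : Tendsto y atTop (𝓝 (innerMap g x)) :=
    ((PiLp.continuous_toLp 2 _).tendsto _).comp (tendsto_pi_nhds.2 fun ik => hux ik.1 ik.2)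
  have hnhds (t : ℝ) (ht : 0 < t) : innerMap g '' Metric.closedBall x t ∈ 𝓝 (innerMap g x) := by
    obtain ⟨r, hr, hsub⟩ := hG t ht
    exact mem_of_superset (Metric.closedBall_mem_nhds _ hr) hsub
  -- The index `j` must be late enough for `y j` to lie in the image of the small ball; `j ≥ N`
  -- makes the chosen indices tend to infinity.
  have hfreq (N : ℕ) : ∃ w ∈ Metric.closedBall x (1 / ((N : ℝ) + 1)), ∃ j ≥ N,
      innerMap g w = y j := by
    obtain ⟨j, hj, hjN⟩ := ((hy.eventually
      (hnhds (1 / ((N : ℝ) + 1)) (by positivity))).and (eventually_ge_atTop N)).exists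
    obtain ⟨w, hw, hwj⟩ := hj
    exact ⟨w, hw, j, hjN, hwj⟩
  choose w hw j hj hwj using hfreq
  have hwx : Tendsto w atTop (𝓝 x) :=
    tendsto_iff_dist_tendsto_zero.2 (squeeze_zero (fun _ => dist_nonneg) hw
      tendsto_one_div_add_atTop_nhds_zero_nat)
  have hjt : Tendsto j atTop atTop := tendsto_atTop_mono hj tendsto_id
  have hgw (N : ℕ) (i : Fin n) (k : Fin h) : g i k (w N) = u i k (j N) :=
    congrArg (fun q : EuclideanSpace ℝ (Fin n × Fin h) => q (i, k)) (hwj N)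
  have hgrad (N : ℕ) := hasGradientAt_twoLayerLoss hl hg v (w N) fun i k => by
    rw [hgw]; exact hu i k _
  have hvw : Tendsto (fun N => (WithLp.toLp 2 (v, w N) : ParamSpace h d)) atTop
      (𝓝 (WithLp.toLp 2 (v, x))) :=
    ((WithLp.prod_continuous_toLp 2 _ _).tendsto (v, x)).comp (tendsto_const_nhds.prodMk_nhds hwx)
  have hda : Tendsto (fun N i k => deriv (σ i k) (u i k (j N))) atTop (𝓝 a) := by
    refine tendsto_pi_nhds.2 fun i => tendsto_pi_nhds.2 fun k => ?_
    simpa only [gradient_eq_deriv'] using! (hua i k).comp hjt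
  have hlim := ((continuous_formalGradient hl hg hσ v).tendsto (x, a)).comp (hwx.prodMk_nhds hda)
  refine ⟨fun N => WithLp.toLp 2 (v, w N), fun N => (hgrad N).differentiableAt, hvw, ?_⟩
  refine hlim.congr fun N => ?_
  rw [(hgrad N).gradient]
  simp only [hgw]
  rfl

/-- A product of convex hulls is the hull of the product, and the preimage of a convex set under an
affine map is convex. -/
theorem image_formalGradient_subset_clarkeSubdifferential
    (hl : ∀ i, StrictlyDifferentiable (l i))
    (hg : ∀ i k, StrictlyDifferentiable (g i k)) (hσ : ∀ i k, LocallyLipschitz (σ i k))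
    (v : EuclideanSpace ℝ (Fin h)) {x : EuclideanSpace ℝ (Fin d)}
    (hG : LocallySurjectiveAt (innerMap g) x) :
    (formalGradient l σ g v x '' Set.univ.pi fun i => Set.univ.pi fun k =>
        clarkeSubdifferential (σ i k) (g i k x)) ⊆
      clarkeSubdifferential (twoLayerLoss l σ g) (WithLp.toLp 2 (v, x)) := by
  rw [Set.image_subset_iff]
  simp only [clarkeSubdifferential, ← convexHull_pi]
  refine convexHull_min (fun a ha => subset_convexHull ℝ _
    (formalGradient_mem_limitingGradients hl hg hσ v hG fun i k => ha i trivial k trivial)) ?_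
  intro a ha b hb s t hs ht hst
  rw [Set.mem_preimage, formalGradient_convex_combination v x hst]
  exact convex_convexHull ℝ _ ha hb hs ht hst

end

theorem mainTheorem11 (n h d : ℕ) (l : Fin n → ℝ → ℝ) (σ : Fin n → Fin h → ℝ → ℝ)
    (g : Fin n → Fin h → EuclideanSpace ℝ (Fin d) → ℝ)
    (hl : ∀ i, StrictlyDifferentiable (l i))
    (hg : ∀ i k, StrictlyDifferentiable (g i k))
    (hσ : ∀ i k, LocallyLipschitz (σ i k))
    (x' : EuclideanSpace ℝ (Fin d))
    (hG : LocallySurjectiveAt (innerMap g) x')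
    (v' : EuclideanSpace ℝ (Fin h)) :
    clarkeSubdifferential (twoLayerLoss l σ g) (WithLp.toLp 2 (v', x')) =
      ∑ i, deriv (l i) (networkOutput σ g v' x' i) •
        paramProd {w | ∀ k, w k ∈ ({σ i k (g i k x')} : Set ℝ)}
          (∑ k, v' k •
            (clarkeSubdifferential (σ i k) (g i k x') •
              ({gradient (g i k) x'} : Set (EuclideanSpace ℝ (Fin d))))) := by
  rw [sum_smul_paramProd_eq_image]
  exact (clarkeSubdifferential_twoLayerLoss_subset hl hg hσ v' x').antisymm
    (image_formalGradient_subset_clarkeSubdifferential hl hg hσ v' hG)
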